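/- Let $P\subseteq\mathbb{R}^d$ be a rational convex polytope (all vertices in $\mathbb{Q}^d$) of dimension $r$, where the empty polytope has dimension $-1$. Let $\mathrm{C}(P)=\{c\,(p,1) : c\ge 0,\ p\in P\}\subseteq\mathbb{R}^{d+1}$ be the cone over $P$, let $w$ be a form of degree $m\ge 0$, that is, a homogeneous polynomial of degree $m$ with real coefficients in $d+1$ variables (the zero polynomial is allowed), and let $$\mathrm{Ehr}(P,w;t)=\sum_{x\in \mathrm{C}(P)\cap\mathbb{Z}^{d+1}} w(x)\,t^{x_{d+1}}\in\mathbb{R}[[t]]$$ be the weighted Ehrhart series. There is a positive integer $q$ such that all vertices of $qP$ lie in $\mathbb{Z}^d$, and for every such $q$ there is a polynomial $h^*_{P,w}\in\mathbb{R}[t]$ of degree at most $q(r+m+1)-1$ (the zero polynomial satisfying every degree bound) such that $$\mathrm{Ehr}(P,w;t)=\frac{h^*_{P,w}(t)}{(1-t^q)^{r+m+1}}.$$ -/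

import Mathlib

open scoped Pointwise

noncomputable section

namespace WeightedEhrhart

/-- A (convex) polytope in `ℝ^d`: the convex hull of finitely many points. -/
def IsPolytope {d : ℕ} (P : Set (Fin d → ℝ)) : Prop :=
  ∃ V : Set (Fin d → ℝ), V.Finite ∧ P = convexHull ℝ V

/-- A rational polytope: all vertices (extreme points) lie in `ℚ^d`. -/
def IsRationalPolytope {d : ℕ} (P : Set (Fin d → ℝ)) : Prop :=
  IsPolytope P ∧ ∀ v ∈ P.extremePoints ℝ, ∀ i, ∃ a : ℚ, v i = (a : ℝ)

/-- A lattice polytope: all vertices (extreme points) lie in `ℤ^d`. -/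
def IsLatticePolytope {d : ℕ} (P : Set (Fin d → ℝ)) : Prop :=
  IsPolytope P ∧ ∀ v ∈ P.extremePoints ℝ, ∀ i, ∃ a : ℤ, v i = (a : ℝ)

open Classical in
/-- The dimension of a convex set, that is, of its affine hull; the empty set has
dimension `-1`. -/
def dimension {d : ℕ} (P : Set (Fin d → ℝ)) : ℤ :=
  if P.Nonempty then (Module.finrank ℝ (vectorSpan ℝ P) : ℤ) else -1

/-- The cone over `P` (its homogenization), `C(P) = {c (p, 1) | c ≥ 0, p ∈ P} ⊆ ℝ^(d+1)`. -/
def cone {d : ℕ} (P : Set (Fin d → ℝ)) : Set (Fin (d + 1) → ℝ) :=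
  {y | ∃ c : ℝ, 0 ≤ c ∧ ∃ p ∈ P, y = c • (Fin.snoc p 1 : Fin (d + 1) → ℝ)}

/-- The integer points `x` of the cone over `P` with last coordinate `x_{d+1} = n`. -/
def latticeSlice {d : ℕ} (P : Set (Fin d → ℝ)) (n : ℕ) : Set (Fin (d + 1) → ℤ) :=
  {x | (fun i => (x i : ℝ)) ∈ cone P ∧ x (Fin.last d) = (n : ℤ)}

/-- The slices of the cone over a polytope contain finitely many integer points, so that the
sums in `ehrhartSeries` are finite sums. -/
theorem latticeSlice_finite {d : ℕ} {P : Set (Fin d → ℝ)} (hP : IsPolytope P) (n : ℕ) :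
    (latticeSlice P n).Finite := by
  obtain ⟨V, hV, rfl⟩ := hP
  obtain ⟨R, hR⟩ := (hV.isCompact_convexHull ℝ).isBounded.exists_norm_le
  set B : ℤ := ⌈(n : ℝ) * R⌉ + n with hB
  refine (Set.finite_Icc (fun _ : Fin (d + 1) => -B) (fun _ => B)).subset ?_
  rintro x ⟨⟨c, hc, p, hp, hx⟩, hn⟩
  have hxi : ∀ i, (x i : ℝ) = c * (Fin.snoc p 1 : Fin (d + 1) → ℝ) i := fun i => congrFun hx i
  have hcn : c = n := by
    have h := hxi (Fin.last d)
    rw [hn] at h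
    simpa using h.symm
  subst hcn
  have hRp := hR p hp
  have hR0 : 0 ≤ R := (norm_nonneg p).trans hRp
  have hle : (n : ℝ) * R ≤ (⌈(n : ℝ) * R⌉ : ℝ) := Int.le_ceil _
  have hnR : 0 ≤ (n : ℝ) * R := by positivity
  have key : ∀ i, |(x i : ℝ)| ≤ (B : ℝ) := by
    intro i
    rw [hB]
    push_cast
    refine Fin.lastCases ?_ (fun j => ?_) i
    · rw [hxi]
      simp only [Fin.snoc_last, mul_one, Nat.abs_cast]
      linarith
    · rw [hxi]
      simp only [Fin.snoc_castSucc, abs_mul, Nat.abs_cast]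
      have h1 : |p j| ≤ R := (norm_le_pi_norm p j).trans hRp
      have h2 : (n : ℝ) * |p j| ≤ n * R := by gcongr
      linarith
  refine ⟨fun i => ?_, fun i => ?_⟩
  · have h := (abs_le.1 (key i)).1
    exact_mod_cast h
  · have h := (abs_le.1 (key i)).2
    exact_mod_cast h

/-- The weighted Ehrhart series `Ehr(P, w; t) = ∑_{x ∈ C(P) ∩ ℤ^(d+1)} w(x) t^(x_{d+1})`,
as a formal power series in `t`. -/
def ehrhartSeries {d : ℕ} (P : Set (Fin d → ℝ)) (w : MvPolynomial (Fin (d + 1)) ℝ) :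
    PowerSeries ℝ :=
  PowerSeries.mk fun n => ∑ᶠ x ∈ latticeSlice P n, MvPolynomial.eval (fun i => (x i : ℝ)) w

end WeightedEhrhart

end

/-! For nonempty `P`, the cone over `P` is generated by the integer vectors `(e, q)`, with `e` a
vertex of `qP`, all of height `q` (`cone_eq_conicHull`). It is cut into disjoint half-open
simplicial cones on linearly independent subsets of these generators
(`exists_halfOpen_decomposition`). Such a subset has at most `dim P + 1` elements, so it suffices to
treat one simplicial cone and bring all pieces to a common denominator.

For one cone (`halfOpenPoints_heightSeries`), translation by a generator multiplies a generating
function by `t^q`. Removing the translated copy gives `(1 - t^q) G_f = G'_f + t^q G_{Δf}`, where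
`G'` has one more coordinate confined to a half-open unit interval and `Δf` is a difference of `f`.
Each step confines a coordinate or lowers the degree of the weight, so only the half-open
parallelepiped remains. Its heights are strictly below `q` times the number of generators because at
least one facet is closed; this strictness gives the degree bound.

The decomposition comes from linear programming. A generic cost selects, for each generic point, the
unique basis of its cheapest nonnegative representation. An arbitrary point is assigned the basis of
a small push in a generic direction `u`, and the signs of the coordinates of `u` decide which facets
are closed. -/

open scoped Pointwise

/-! ### Generating functions graded by height -/

namespace WeightedEhrhart

/-- The points of `X` at height `n`. -/
def slice {d : ℕ} (X : Set (Fin (d + 1) → ℤ)) (n : ℕ) : Set (Fin (d + 1) → ℤ) :=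
  {x | x ∈ X ∧ x (Fin.last d) = (n : ℤ)}

/-- The generating function `∑_{x ∈ X} f(x) t^(x_{d+1})`. -/
noncomputable def heightSeries {d : ℕ} (X : Set (Fin (d + 1) → ℤ))
    (f : (Fin (d + 1) → ℤ) → ℝ) : PowerSeries ℝ :=
  PowerSeries.mk fun n => ∑ᶠ x ∈ slice X n, f x

/-- Finiteness of the slices matters: a `finsum` with infinite support takes the default value zero
and is not additive. -/
theorem heightSeries_add {d : ℕ} {X : Set (Fin (d + 1) → ℤ)} (hX : ∀ n, (slice X n).Finite)
    (f g : (Fin (d + 1) → ℤ) → ℝ) :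
    heightSeries X (fun x => f x + g x) = heightSeries X f + heightSeries X g := by
  ext n
  simp only [heightSeries, PowerSeries.coeff_mk, map_add]
  exact finsum_mem_add_distrib (hX n)

theorem heightSeries_zero {d : ℕ} (X : Set (Fin (d + 1) → ℤ)) :
    heightSeries X (fun _ => 0) = 0 := by
  ext n
  simp [heightSeries]

theorem heightSeries_biUnion {d : ℕ} {κ : Type*} (F : Finset κ)
    (X : κ → Set (Fin (d + 1) → ℤ)) (hX : ∀ S ∈ F, ∀ n, (slice (X S) n).Finite)
    (hdis : (F : Set κ).PairwiseDisjoint X) (f : (Fin (d + 1) → ℤ) → ℝ) :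
    heightSeries (⋃ S ∈ F, X S) f = ∑ S ∈ F, heightSeries (X S) f := by
  ext n
  simp only [heightSeries, PowerSeries.coeff_mk, map_sum]
  have h1 : slice (⋃ S ∈ F, X S) n = ⋃ S ∈ (F : Set κ), slice (X S) n := by
    ext x
    simp only [slice, Set.mem_iUnion, Set.mem_ofPred_eq, Finset.mem_coe, exists_prop]
    grind
  rw [h1, finsum_mem_biUnion _ F.finite_toSet (fun S hS => hX S hS n), finsum_mem_coe_finset]
  intro S hS S' hS' hne
  exact (hdis hS hS' hne).mono (fun _ h => h.1) (fun _ h => h.1)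

theorem heightSeries_union {d : ℕ} {X Y : Set (Fin (d + 1) → ℤ)}
    (hX : ∀ n, (slice X n).Finite) (hY : ∀ n, (slice Y n).Finite) (hdis : Disjoint X Y)
    (f : (Fin (d + 1) → ℤ) → ℝ) :
    heightSeries (X ∪ Y) f = heightSeries X f + heightSeries Y f := by
  ext n
  simp only [heightSeries, PowerSeries.coeff_mk, map_add]
  have h1 : slice (X ∪ Y) n = slice X n ∪ slice Y n := by
    ext x
    simp [slice, or_and_right]
  rw [h1, finsum_mem_union _ (hX n) (hY n)]
  exact hdis.mono (fun _ h => h.1) (fun _ h => h.1)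

theorem heightSeries_translate {d : ℕ} {X : Set (Fin (d + 1) → ℤ)}
    (hX : ∀ x ∈ X, 0 ≤ x (Fin.last d)) (v : Fin (d + 1) → ℤ) (q : ℕ)
    (hv : v (Fin.last d) = q) (f : (Fin (d + 1) → ℤ) → ℝ) :
    heightSeries ((fun x => x + v) '' X) f
      = PowerSeries.X ^ q * heightSeries X (fun x => f (x + v)) := by
  ext n
  rw [PowerSeries.coeff_X_pow_mul']
  simp only [heightSeries, PowerSeries.coeff_mk]
  split_ifs with h
  · have h1 : slice ((fun x => x + v) '' X) n = (fun x => x + v) '' slice X (n - q) := by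
      ext x
      constructor
      · rintro ⟨⟨y, hy, rfl⟩, hn⟩
        refine ⟨y, ⟨hy, ?_⟩, rfl⟩
        simp only [Pi.add_apply, hv] at hn
        omega
      · rintro ⟨y, ⟨hy, hn⟩, rfl⟩
        refine ⟨⟨y, hy, rfl⟩, ?_⟩
        simp only [Pi.add_apply, hv]
        omega
    rw [h1, finsum_mem_image (add_left_injective v).injOn]
  · have h1 : slice ((fun x => x + v) '' X) n = ∅ := by
      ext x
      simp only [Set.mem_empty_iff_false, iff_false]
      rintro ⟨⟨y, hy, rfl⟩, hn⟩
      have := hX y hy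
      simp only [Pi.add_apply, hv] at hn
      omega
    rw [h1, finsum_mem_empty]

/-! ### Polynomial weights through finite differences -/

/-- Functions on an additive group that behave like polynomials of degree at most `m`: the
`(m + 1)`-st differences vanish. -/
def IsPolyLE {A : Type*} [AddCommGroup A] : ℕ → (A → ℝ) → Prop
  | 0, f => ∀ v x, f (x + v) = f x
  | m + 1, f => ∀ v, IsPolyLE m fun x => f (x + v) - f x

section IsPolyLE

variable {A : Type*} [AddCommGroup A]

theorem IsPolyLE.add {m : ℕ} {f g : A → ℝ} (hf : IsPolyLE m f) (hg : IsPolyLE m g) :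
    IsPolyLE m (fun x => f x + g x) := by
  induction m generalizing f g with
  | zero => intro v x; simp only [hf v x, hg v x]
  | succ m ih =>
    intro v
    convert ih (hf v) (hg v) using 2
    ring

theorem IsPolyLE.const_mul {m : ℕ} {f : A → ℝ} (hf : IsPolyLE m f) (c : ℝ) :
    IsPolyLE m (fun x => c * f x) := by
  induction m generalizing f with
  | zero => intro v x; simp only [hf v x]
  | succ m ih =>
    intro v
    convert ih (hf v) using 2
    ring

theorem IsPolyLE.translate {m : ℕ} {f : A → ℝ} (hf : IsPolyLE m f) (a : A) :
    IsPolyLE m (fun x => f (x + a)) := by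
  induction m generalizing f with
  | zero =>
    intro v x
    simp only [hf a, hf v]
  | succ m ih =>
    intro v
    convert ih (hf v) using 3
    rw [add_right_comm]

theorem IsPolyLE.const (m : ℕ) (c : ℝ) : IsPolyLE m (fun _ : A => c) := by
  induction m generalizing c with
  | zero => intro v x; rfl
  | succ m ih =>
    intro v
    exact ih (c - c)

theorem IsPolyLE.sum {m : ℕ} {κ : Type*} (s : Finset κ) {f : κ → A → ℝ}
    (hf : ∀ k ∈ s, IsPolyLE m (f k)) : IsPolyLE m (fun x => ∑ k ∈ s, f k x) := by
  classical
  induction s using Finset.induction_on with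
  | empty => simpa using IsPolyLE.const (A := A) m 0
  | insert a s ha ih =>
    simp only [Finset.sum_insert ha]
    exact (hf a (by simp)).add (ih fun k hk => hf k (by simp [hk]))

/-- Discrete Leibniz rule: `Δ_v (l g)(x) = l(x) Δ_v g(x) + l(v) g(x + v)`. -/
theorem IsPolyLE.hom_mul {m : ℕ} {g : A → ℝ} (hg : IsPolyLE m g) (l : A →+ ℝ) :
    IsPolyLE (m + 1) (fun x => l x * g x) := by
  induction m generalizing g with
  | zero =>
    intro v
    convert IsPolyLE.const (A := A) 0 (l v * g 0) using 2 with x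
    have h1 := hg v x
    have h2 := hg x 0
    rw [zero_add] at h2
    simp only [h1, map_add, h2]
    ring
  | succ m ih =>
    intro v
    convert (ih (hg v)).add ((hg.translate v).const_mul (l v)) using 2 with x
    simp only [map_add]
    ring

end IsPolyLE

theorem isPolyLE_eval {n m : ℕ} {w : MvPolynomial (Fin n) ℝ} (hw : w.IsHomogeneous m) :
    IsPolyLE m (fun x : Fin n → ℤ => MvPolynomial.eval (fun i => (x i : ℝ)) w) := by
  classical
  have hpow : ∀ (i : Fin n) (k b : ℕ) (g : (Fin n → ℤ) → ℝ), IsPolyLE b g →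
      IsPolyLE (k + b) (fun x => (x i : ℝ) ^ k * g x) := by
    intro i k b g hg
    induction k with
    | zero => simpa using hg
    | succ k ih =>
      have := ih.hom_mul ((Int.castAddHom ℝ).comp (Pi.evalAddMonoidHom (fun _ : Fin n => ℤ) i))
      rw [Nat.add_right_comm]
      convert this using 2 with x
      simp only [AddMonoidHom.coe_comp, Int.coe_castAddHom, Function.comp_apply,
        Pi.evalAddMonoidHom_apply]
      ring
  have hprod : ∀ (e : Fin n → ℕ) (s : Finset (Fin n)),
      IsPolyLE (∑ i ∈ s, e i) (fun x : Fin n → ℤ => ∏ i ∈ s, (x i : ℝ) ^ e i) := by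
    intro e s
    induction s using Finset.induction_on with
    | empty => simpa using IsPolyLE.const (A := Fin n → ℤ) 0 1
    | insert a s ha ih =>
      simp only [Finset.sum_insert ha, Finset.prod_insert ha]
      exact hpow a _ _ _ ih
  simp only [MvPolynomial.eval_eq]
  refine IsPolyLE.sum _ fun e he => ?_
  refine IsPolyLE.const_mul ?_ _
  have := hprod e e.support
  have hd : e.degree = m := by
    rw [Finsupp.degree_eq_weight_one]
    exact hw (MvPolynomial.mem_support_iff.1 he)
  rw [← hd]
  exact this

/-! ### Lattice points of a half-open simplicial cone -/

/-- `a` lies in the ray `[0, ∞)` or `(0, ∞)`, according to `b`. -/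
def InRay (b : Prop) (a : ℝ) : Prop := 0 < a ∨ (a = 0 ∧ b)

theorem InRay.nonneg {b : Prop} {a : ℝ} (h : InRay b a) : 0 ≤ a := by
  rcases h with h | h
  · exact h.le
  · exact h.1.ge

theorem InRay.add_one {b : Prop} {a : ℝ} (h : InRay b a) : InRay b (a + 1) :=
  Or.inl (by linarith [h.nonneg])

theorem degree_mul_lt_of_lt_of_natDegree_le {f g : Polynomial ℝ} {a b : ℕ}
    (hf : f.degree < (a : WithBot ℕ)) (hg : g.natDegree ≤ b) :
    (f * g).degree < ((a + b : ℕ) : WithBot ℕ) := by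
  by_cases h0 : f = 0
  · simp [h0]
  · rw [Polynomial.degree_eq_natDegree h0, Nat.cast_lt] at hf
    refine lt_of_le_of_lt Polynomial.degree_le_natDegree ?_
    rw [Nat.cast_lt]
    have := Polynomial.natDegree_mul_le (p := f) (q := g)
    omega

theorem natDegree_one_sub_X_pow_pow_le (q m : ℕ) :
    ((1 - Polynomial.X ^ q : Polynomial ℝ) ^ m).natDegree ≤ q * m := by
  refine Polynomial.natDegree_pow_le.trans ?_
  rw [mul_comm]
  refine Nat.mul_le_mul_right _ ?_
  refine (Polynomial.natDegree_sub_le _ _).trans ?_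
  simp

/-- Enlarging the denominator costs exactly `q` in the degree bound per factor, so the bound
survives passing to a common denominator. -/
theorem exists_polynomial_mul {F : PowerSeries ℝ} {q a D : ℕ}
    (h : ∃ h : Polynomial ℝ, h.degree < (D : WithBot ℕ) ∧
      F * (1 - PowerSeries.X ^ q) ^ a = (h : PowerSeries ℝ)) (b : ℕ) :
    ∃ h : Polynomial ℝ, h.degree < ((D + q * b : ℕ) : WithBot ℕ) ∧
      F * (1 - PowerSeries.X ^ q) ^ (a + b) = (h : PowerSeries ℝ) := by
  obtain ⟨h, hd, he⟩ := h
  refine ⟨h * (1 - Polynomial.X ^ q) ^ b,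
    degree_mul_lt_of_lt_of_natDegree_le hd (natDegree_one_sub_X_pow_pow_le q b), ?_⟩
  rw [pow_add, ← mul_assoc, he]
  simp

theorem slice_subset {d : ℕ} {X Y : Set (Fin (d + 1) → ℤ)} (h : X ⊆ Y) (n : ℕ) :
    slice X n ⊆ slice Y n := fun _ hx => ⟨h hx.1, hx.2⟩

theorem heightSeries_eq_polynomial {d : ℕ} {X : Set (Fin (d + 1) → ℤ)} {D : ℕ}
    (hX : ∀ x ∈ X, x (Fin.last d) < D) (f : (Fin (d + 1) → ℤ) → ℝ) :
    ∃ h : Polynomial ℝ, h.degree < (D : WithBot ℕ) ∧ heightSeries X f = (h : PowerSeries ℝ) := by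
  refine ⟨(heightSeries X f).trunc D, PowerSeries.degree_trunc_lt _ _, ?_⟩
  ext n
  rw [Polynomial.coeff_coe, PowerSeries.coeff_trunc]
  split_ifs with h
  · rfl
  · have h1 : slice X n = ∅ := by
      ext x
      simp only [Set.mem_empty_iff_false, iff_false]
      rintro ⟨hx, hn⟩
      have := hX x hx
      omega
    simp [heightSeries, h1]

/-- The integer points of a half-open simplicial cone with coordinate functionals `φ i`, `i ∈ S`,
whose coordinates outside `T` are reduced to a half-open unit interval. -/
def halfOpenPoints {d : ℕ} {ι : Type*} (W : Submodule ℝ (Fin (d + 1) → ℝ)) (S : Finset ι)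
    (φ : ι → (Fin (d + 1) → ℝ) →ₗ[ℝ] ℝ) (b : ι → Prop) (T : Finset ι) :
    Set (Fin (d + 1) → ℤ) :=
  {x | (fun i => (x i : ℝ)) ∈ W ∧ (∀ i ∈ S, InRay (b i) (φ i fun i => (x i : ℝ))) ∧
    ∀ i ∈ S, i ∉ T → ¬ InRay (b i) ((φ i fun i => (x i : ℝ)) - 1)}

/-- `T` holds the coordinates still unbounded. Double induction on `T` and on the degree `m`; the
degree bound does not involve `T`, since freeing a coordinate only adds a factor to the denominator.
-/
theorem halfOpenPoints_heightSeries {d : ℕ} {ι : Type*} [DecidableEq ι]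
    {W : Submodule ℝ (Fin (d + 1) → ℝ)} {S : Finset ι}
    {φ : ι → (Fin (d + 1) → ℝ) →ₗ[ℝ] ℝ} {b : ι → Prop} {q : ℕ} (hq : 0 < q)
    (v : ι → Fin (d + 1) → ℤ) (hv : ∀ i, v i (Fin.last d) = q)
    (hvW : ∀ i, (fun k => (v i k : ℝ)) ∈ W)
    (hexp : ∀ x ∈ W, ∑ i ∈ S, φ i x • (fun k => (v i k : ℝ)) = x)
    (hdual : ∀ i ∈ S, ∀ j ∈ S, φ i (fun k => (v j k : ℝ)) = if i = j then 1 else 0)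
    (hb : ∃ i ∈ S, b i)
    (hfin : ∀ n, (slice (halfOpenPoints W S φ b S) n).Finite)
    (T : Finset ι) (hT : T ⊆ S) (m : ℕ) (f : (Fin (d + 1) → ℤ) → ℝ) (hf : IsPolyLE m f) :
    ∃ h : Polynomial ℝ, h.degree < ((q * S.card + q * m : ℕ) : WithBot ℕ) ∧
      heightSeries (halfOpenPoints W S φ b T) f * (1 - PowerSeries.X ^ q) ^ (T.card + m)
        = (h : PowerSeries ℝ) := by
  have hsub : ∀ T, halfOpenPoints W S φ b T ⊆ halfOpenPoints W S φ b S :=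
    fun T x hx => ⟨hx.1, hx.2.1, fun i hi hi' => absurd hi hi'⟩
  have hfin' : ∀ T n, (slice (halfOpenPoints W S φ b T) n).Finite :=
    fun T n => (hfin n).subset (slice_subset (hsub T) n)
  have hheight : ∀ T, ∀ x ∈ halfOpenPoints W S φ b T,
      (x (Fin.last d) : ℝ) = ∑ i ∈ S, (φ i fun i => (x i : ℝ)) * q := by
    intro T x hx
    have h := congrFun (hexp _ hx.1) (Fin.last d)
    rw [← h]
    simp [hv]
  have hnonneg : ∀ T, ∀ x ∈ halfOpenPoints W S φ b T, 0 ≤ x (Fin.last d) := by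
    intro T x hx
    have h : (0 : ℝ) ≤ x (Fin.last d) := by
      rw [hheight T x hx]
      exact Finset.sum_nonneg fun i hi => mul_nonneg (hx.2.1 i hi).nonneg (Nat.cast_nonneg q)
    exact_mod_cast h
  induction T using Finset.induction_on generalizing m f with
  | empty =>
    have hlt : ∀ x ∈ halfOpenPoints W S φ b ∅, x (Fin.last d) < ((q * S.card : ℕ) : ℤ) := by
      intro x hx
      have h : (x (Fin.last d) : ℝ) < q * S.card := by
        rw [hheight _ x hx]
        have hq' : (0 : ℝ) < q := by exact_mod_cast hq
        -- A confined coordinate lies in `[0, 1)` if its ray is closed and in `(0, 1]` if open. The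
        -- closed one supplied by `hb` makes the sum strictly smaller.
        have h2 : ∑ i ∈ S, (φ i fun i => (x i : ℝ)) * q < ∑ i ∈ S, (q : ℝ) := by
          obtain ⟨i, hi, hbi⟩ := hb
          have hle : ∀ i ∈ S, (φ i fun i => (x i : ℝ)) ≤ 1 := by
            intro i hi
            by_contra hcon
            exact hx.2.2 i hi (by simp) (Or.inl (by linarith))
          refine Finset.sum_lt_sum (fun i hi => by nlinarith [hle i hi]) ⟨i, hi, ?_⟩
          have hlt : (φ i fun i => (x i : ℝ)) < 1 := by
            refine lt_of_le_of_ne (hle i hi) fun hcon => ?_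
            exact hx.2.2 i hi (by simp) (Or.inr ⟨by linarith, hbi⟩)
          nlinarith
        rw [Finset.sum_const, nsmul_eq_mul, mul_comm] at h2
        exact h2
      exact_mod_cast h
    obtain ⟨h, hd, he⟩ := heightSeries_eq_polynomial hlt f
    have := exists_polynomial_mul (F := heightSeries (halfOpenPoints W S φ b ∅) f) (q := q)
      (a := 0) (D := q * S.card) ⟨h, hd, by simpa using he⟩ m
    simpa using this
  | insert i T hi ih =>
    have hiS : i ∈ S := hT (Finset.mem_insert_self i T)
    have hTS : T ⊆ S := (Finset.subset_insert i T).trans hT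
    have hφadd : ∀ (x : Fin (d + 1) → ℤ) j, j ∈ S →
        (φ j fun k => ((x + v i) k : ℝ)) = (φ j fun k => (x k : ℝ)) + if j = i then 1 else 0 := by
      intro x j hj
      rw [← hdual j hj i hiS, ← map_add]
      congr 1
      ext k
      simp
    -- Either subtracting `v i` leaves the ray in coordinate `i`, which is the confinement
    -- condition, or the point is a translate by `v i`.
    have hsplit : halfOpenPoints W S φ b (insert i T) = halfOpenPoints W S φ b T ∪
        (fun x => x + v i) '' halfOpenPoints W S φ b (insert i T) := by
      ext x
      constructor
      · intro hx
        by_cases hray : InRay (b i) ((φ i fun i => (x i : ℝ)) - 1)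
        · right
          have hx' : x - v i + v i = x := sub_add_cancel _ _
          have hval : ∀ j ∈ S, (φ j fun k => ((x - v i) k : ℝ))
              = (φ j fun k => (x k : ℝ)) - if j = i then 1 else 0 := by
            intro j hj
            have := hφadd (x - v i) j hj
            rw [hx'] at this
            linarith
          refine ⟨x - v i, ⟨?_, ?_, ?_⟩, hx'⟩
          · have := W.sub_mem hx.1 (hvW i)
            convert this using 1
            ext k
            simp
          · intro j hj
            rw [hval j hj]
            split_ifs with h
            · subst h
              exact hray
            · simpa using hx.2.1 j hj
          · intro j hj hjT
            rw [hval j hj, if_neg (fun h : j = i => hjT (by simp [h])), sub_zero]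
            exact hx.2.2 j hj hjT
        · left
          refine ⟨hx.1, hx.2.1, fun j hj hjT => ?_⟩
          by_cases h : j = i
          · subst h
            exact hray
          · exact hx.2.2 j hj (by simp [h, hjT])
      · rintro (hx | ⟨y, hy, rfl⟩)
        · exact ⟨hx.1, hx.2.1, fun j hj hjT =>
            hx.2.2 j hj fun h => hjT (Finset.mem_insert_of_mem h)⟩
        · refine ⟨?_, ?_, ?_⟩
          · have := W.add_mem hy.1 (hvW i)
            convert this using 1
            ext k
            simp
          · intro j hj
            have := hφadd y j hj
            simp only at this ⊢
            rw [this]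
            split_ifs with h
            · exact (hy.2.1 j hj).add_one
            · simpa using hy.2.1 j hj
          · intro j hj hjT
            have := hφadd y j hj
            simp only at this ⊢
            rw [this, if_neg (fun h : j = i => hjT (by simp [h])), add_zero]
            exact hy.2.2 j hj hjT
    have hdis : Disjoint (halfOpenPoints W S φ b T)
        ((fun x => x + v i) '' halfOpenPoints W S φ b (insert i T)) := by
      rw [Set.disjoint_left]
      rintro x hx ⟨y, hy, rfl⟩
      refine hx.2.2 i hiS hi ?_
      have := hφadd y i hiS
      simp only at this ⊢
      rw [this, if_pos trivial, add_sub_cancel_right]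
      exact hy.2.1 i hiS
    have hrec : ∀ g : (Fin (d + 1) → ℤ) → ℝ,
        heightSeries (halfOpenPoints W S φ b (insert i T)) g * (1 - PowerSeries.X ^ q)
          = heightSeries (halfOpenPoints W S φ b T) g + PowerSeries.X ^ q *
            heightSeries (halfOpenPoints W S φ b (insert i T)) (fun x => g (x + v i) - g x) := by
      intro g
      have h1 : heightSeries (halfOpenPoints W S φ b (insert i T)) g =
          heightSeries (halfOpenPoints W S φ b T) g + PowerSeries.X ^ q *
            heightSeries (halfOpenPoints W S φ b (insert i T)) (fun x => g (x + v i)) := by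
        rw [← heightSeries_translate (hnonneg _) (v i) q (hv i), ← heightSeries_union (hfin' _) _ hdis,
          ← hsplit]
        intro n
        refine (hfin' (insert i T) n).subset (slice_subset ?_ n)
        conv_rhs => rw [hsplit]
        exact Set.subset_union_right
      have h2 := heightSeries_add (hfin' (insert i T)) (fun x => g (x + v i) - g x) g
      simp only [sub_add_cancel] at h2
      rw [h2] at h1
      linear_combination h1
    rw [Finset.card_insert_of_notMem hi]
    -- In degree zero the difference term of `hrec` vanishes; otherwise it has degree one less, and
    -- its factor `t^q` uses the extra `q` in the bound.
    induction m generalizing f with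
    | zero =>
      obtain ⟨h, hd, he⟩ := ih hTS 0 f hf
      refine ⟨h, hd, ?_⟩
      have h0 := hrec f
      have hf0 : (fun x => f (x + v i) - f x) = fun _ => 0 := by
        ext x
        rw [hf (v i) x, sub_self]
      rw [hf0, heightSeries_zero, mul_zero, add_zero] at h0
      rw [← he, ← h0]
      ring
    | succ m ihm =>
      obtain ⟨h₁, hd₁, he₁⟩ := ih hTS (m + 1) f hf
      obtain ⟨h₂, hd₂, he₂⟩ := ihm _ (hf (v i))
      refine ⟨h₁ + h₂ * Polynomial.X ^ q, ?_, ?_⟩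
      · refine lt_of_le_of_lt (Polynomial.degree_add_le _ _) (max_lt hd₁ ?_)
        have := degree_mul_lt_of_lt_of_natDegree_le hd₂ (Polynomial.natDegree_X_pow (R := ℝ) q).le
        rwa [mul_add, mul_one, ← add_assoc]
      · have h0 := hrec f
        simp only [Polynomial.coe_add, Polynomial.coe_mul, Polynomial.coe_pow, Polynomial.coe_X]
        rw [← he₁, ← he₂]
        linear_combination (1 - PowerSeries.X ^ q) ^ (T.card + (m + 1)) * h0

end WeightedEhrhart

namespace WeightedEhrhart

/-! ### Generic vectors and infinitesimal pushes -/

open Filter Topology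

/-- Finitely many nonzero linear forms are all nonzero at some positive vector. -/
theorem exists_pos_forall_sum_ne_zero {ι : Type*} [Fintype ι] (A : Set (ι → ℝ)) (hA : A.Finite)
    (h0 : ∀ a ∈ A, a ≠ 0) : ∃ c : ι → ℝ, (∀ i, 0 < c i) ∧ ∀ a ∈ A, ∑ i, c i * a i ≠ 0 := by
  classical
  let e := Fintype.equivFin ι
  let p : (ι → ℝ) → Polynomial ℝ := fun a => ∑ i, Polynomial.C (a i) * Polynomial.X ^ (e i : ℕ)
  have hp : ∀ a, a ≠ 0 → p a ≠ 0 := by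
    intro a ha hpa
    obtain ⟨i, hi⟩ := Function.ne_iff.1 ha
    apply hi
    have h := congrArg (fun r => Polynomial.coeff r (e i : ℕ)) hpa
    simp only [p, Polynomial.finsetSum_coeff, Polynomial.coeff_C_mul, Polynomial.coeff_X_pow,
      Polynomial.coeff_zero] at h
    rw [Finset.sum_eq_single i] at h
    · simpa using h
    · intro j _ hj
      rw [if_neg, mul_zero]
      exact fun h => hj (e.injective (Fin.ext h)).symm
    · simp
  have hfin : (⋃ a ∈ A, {t | (p a).IsRoot t}).Finite :=
    hA.biUnion fun a ha => Polynomial.finite_setOfPred_isRoot (hp a (h0 a ha))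
  obtain ⟨t, ht, htn⟩ := (Set.Ioi_infinite (0 : ℝ)).exists_notMem_finite hfin
  refine ⟨fun i => t ^ (e i : ℕ), fun i => pow_pos ht _, fun a ha hs => htn ?_⟩
  simp only [Set.mem_iUnion]
  refine ⟨a, ha, ?_⟩
  simp only [Set.mem_ofPred_eq, Polynomial.IsRoot.def, p, Polynomial.eval_finsetSum,
    Polynomial.eval_mul, Polynomial.eval_C, Polynomial.eval_pow, Polynomial.eval_X]
  rw [← hs]
  exact Finset.sum_congr rfl fun i _ => mul_comm _ _

theorem eventually_add_mul_ne_zero (a : ℝ) {b : ℝ} (hb : b ≠ 0) :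
    ∀ᶠ ε in 𝓝[>] (0 : ℝ), a + ε * b ≠ 0 := by
  have h : ∀ᶠ ε in 𝓝[≠] (0 : ℝ), ε ≠ -a / b ∨ a = 0 := by
    by_cases ha : a = 0
    · simp [ha]
    · have : (0 : ℝ) ≠ -a / b := (div_ne_zero (neg_ne_zero.2 ha) hb).symm
      exact Eventually.mono (mem_nhdsWithin_of_mem_nhds (isOpen_ne.mem_nhds this) : ∀ᶠ ε in 𝓝[≠] (0 : ℝ),
        ε ≠ -a / b) fun _ h => Or.inl h
  have h' := h.filter_mono (nhdsWithin_mono 0 fun x (hx : 0 < x) => hx.ne')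
  filter_upwards [h', self_mem_nhdsWithin] with ε h1 hε h0
  rcases h1 with h1 | h1
  · apply h1
    rw [eq_div_iff hb]
    linarith
  · rw [h1, zero_add] at h0
    exact (mul_ne_zero (ne_of_gt hε) hb) h0

/-- With the next lemma: lying in the half-open ray means being positive after an infinitesimal push
with velocity `b`. "Frequently" suffices for the converse, which allows a pigeonhole over bases. -/
theorem InRay.eventually_pos {a b : ℝ} (h : InRay (0 < b) a) :
    ∀ᶠ ε in 𝓝[>] (0 : ℝ), 0 < a + ε * b := by
  rcases h with h | ⟨rfl, hb⟩
  · have ht : Tendsto (fun ε : ℝ => a + ε * b) (𝓝[>] 0) (𝓝 (a + 0 * b)) :=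
      (Continuous.tendsto (by fun_prop) 0).mono_left nhdsWithin_le_nhds
    rw [zero_mul, add_zero] at ht
    exact ht.eventually (lt_mem_nhds h)
  · filter_upwards [self_mem_nhdsWithin] with ε hε
    rw [zero_add]
    exact mul_pos hε hb

theorem inRay_of_frequently_pos {a b : ℝ} (h : ∃ᶠ ε in 𝓝[>] (0 : ℝ), 0 < a + ε * b) :
    InRay (0 < b) a := by
  by_contra hcon
  apply h
  simp only [InRay, not_or, not_and, not_lt] at hcon
  rcases hcon.1.lt_or_eq with ha | ha
  · have ht : Tendsto (fun ε : ℝ => a + ε * b) (𝓝[>] 0) (𝓝 (a + 0 * b)) :=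
      (Continuous.tendsto (by fun_prop) 0).mono_left nhdsWithin_le_nhds
    rw [zero_mul, add_zero] at ht
    exact (ht.eventually (gt_mem_nhds ha)).mono fun _ h => not_lt.2 h.le
  · filter_upwards [self_mem_nhdsWithin] with ε hε
    rw [ha, zero_add, not_lt]
    exact mul_nonpos_of_nonneg_of_nonpos (le_of_lt hε) (hcon.2 ha)

/-! ### Half-open decomposition by linear programming -/

section Geometry

variable {n : ℕ} {ι : Type*}

section Cones

variable [Fintype ι]

/-- The finitely generated cone spanned by the vectors `v i`. -/
def conicHull (v : ι → Fin n → ℝ) : Set (Fin n → ℝ) :=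
  {y | ∃ l : ι → ℝ, (∀ i, 0 ≤ l i) ∧ ∑ i, l i • v i = y}

/-- A point lying in no proper subspace spanned by some of the `v i`. -/
def IsGenericPoint (v : ι → Fin n → ℝ) (y : Fin n → ℝ) : Prop :=
  ∀ T : Finset ι, y ∈ Submodule.span ℝ (v '' T) →
    Submodule.span ℝ (v '' T) = Submodule.span ℝ (Set.range v)

theorem exists_pos_perturbation {l a : ι → ℝ} (hl : ∀ i, 0 ≤ l i) (ha : ∀ i, l i = 0 → 0 ≤ a i) :
    ∃ δ : ℝ, 0 < δ ∧ ∀ i, 0 ≤ l i + δ * a i := by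
  have h : ∀ᶠ δ in 𝓝[>] (0 : ℝ), ∀ i, 0 ≤ l i + δ * a i := by
    rw [eventually_all]
    intro i
    rcases (hl i).eq_or_lt with h | h
    · filter_upwards [self_mem_nhdsWithin] with δ hδ
      rw [← h, zero_add]
      exact mul_nonneg (le_of_lt hδ) (ha i h.symm)
    · have ht : Tendsto (fun δ : ℝ => l i + δ * a i) (𝓝[>] 0) (𝓝 (l i + 0 * a i)) :=
        (Continuous.tendsto (by fun_prop) 0).mono_left nhdsWithin_le_nhds
      rw [zero_mul, add_zero] at ht
      exact (ht.eventually (lt_mem_nhds h)).mono fun _ h => h.le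
  obtain ⟨δ, h1, h2⟩ := (h.and self_mem_nhdsWithin).exists
  exact ⟨δ, h2, h1⟩

/-- Positivity of `ht` on the generators bounds every coefficient, so the feasible set is compact
and the cost has a minimizer. The last clause is optimality along feasible directions `a`. -/
theorem exists_optimal_representation {v : ι → Fin n → ℝ} (ht : (Fin n → ℝ) →ₗ[ℝ] ℝ)
    (hht : ∀ i, 0 < ht (v i)) (c : ι → ℝ) {y : Fin n → ℝ} (hy : y ∈ conicHull v) :
    ∃ l : ι → ℝ, (∀ i, 0 ≤ l i) ∧ ∑ i, l i • v i = y ∧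
      ∀ a : ι → ℝ, ∑ i, a i • v i = 0 → (∀ i, l i = 0 → 0 ≤ a i) → 0 ≤ ∑ i, c i * a i := by
  let K : Set (ι → ℝ) := Set.Icc 0 (fun i => ht y / ht (v i)) ∩ {l | ∑ i, l i • v i = y}
  have hKmem : ∀ l : ι → ℝ, (∀ i, 0 ≤ l i) → ∑ i, l i • v i = y → l ∈ K := by
    intro l hl hs
    refine ⟨⟨fun i => hl i, fun i => ?_⟩, hs⟩
    rw [le_div_iff₀ (hht i), ← hs, map_sum]
    simp only [map_smul, smul_eq_mul]
    exact Finset.single_le_sum (f := fun i => l i * ht (v i))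
      (fun j _ => mul_nonneg (hl j) (hht j).le) (Finset.mem_univ i)
  have hKc : IsCompact K :=
    isCompact_Icc.inter_right (isClosed_eq (by fun_prop) continuous_const)
  obtain ⟨l₀, hl₀, hs₀⟩ := hy
  obtain ⟨l, hlK, hmin⟩ := hKc.exists_isMinOn ⟨l₀, hKmem l₀ hl₀ hs₀⟩
    (f := fun l => ∑ i, c i * l i) (by fun_prop)
  have hl : ∀ i, 0 ≤ l i := fun i => hlK.1.1 i
  refine ⟨l, hl, hlK.2, fun a ha hpos => ?_⟩
  obtain ⟨δ, hδ, hδl⟩ := exists_pos_perturbation hl hpos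
  have hmem : (fun i => l i + δ * a i) ∈ K := by
    refine hKmem _ hδl ?_
    simp only [add_smul, Finset.sum_add_distrib, mul_smul]
    rw [← Finset.smul_sum, ha, smul_zero, add_zero]
    exact hlK.2
  have h1 := isMinOn_iff.1 hmin _ hmem
  simp only [mul_add, Finset.sum_add_distrib] at h1
  have h2 : ∑ i, c i * (δ * a i) = δ * ∑ i, c i * a i := by
    rw [Finset.mul_sum]
    exact Finset.sum_congr rfl fun i _ => by ring
  rw [h2] at h1
  nlinarith

/-- A positive combination of the `v i` such that small perturbations in its direction are
generic. -/
theorem exists_generic_direction (v : ι → Fin n → ℝ) :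
    ∃ c : ι → ℝ, (∀ i, 0 < c i) ∧
      ∀ x, ∀ᶠ ε in 𝓝[>] (0 : ℝ), IsGenericPoint v (x + ε • ∑ i, c i • v i) := by
  let κ := {T : Finset ι // Submodule.span ℝ (v '' T) ≠ Submodule.span ℝ (Set.range v)}
  have hf : ∀ T : κ, ∃ f : (Fin n → ℝ) →ₗ[ℝ] ℝ, (fun i => f (v i)) ≠ 0 ∧
      ∀ x ∈ Submodule.span ℝ (v '' T.1), f x = 0 := by
    rintro ⟨T, hT⟩
    have : ∃ i, v i ∉ Submodule.span ℝ (v '' T) := by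
      by_contra! h
      refine hT (le_antisymm (Submodule.span_mono (Set.image_subset_range _ _)) ?_)
      rw [Submodule.span_le]
      rintro _ ⟨i, rfl⟩
      exact h i
    obtain ⟨i, hi⟩ := this
    obtain ⟨f, hf, hfT⟩ := Submodule.exists_le_ker_of_notMem hi
    exact ⟨f, Function.ne_iff.2 ⟨i, hf⟩, fun x hx => hfT hx⟩
  choose f hf0 hfT using hf
  -- Each `f T` cuts out a hyperplane containing a proper subspace to be avoided; `c` makes the
  -- direction transverse to all of them.
  obtain ⟨c, hc, hcA⟩ := exists_pos_forall_sum_ne_zero (Set.range fun (T : κ) i => f T (v i))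
    (Set.finite_range _) (by rintro _ ⟨T, rfl⟩; exact hf0 T)
  refine ⟨c, hc, fun x => ?_⟩
  have h : ∀ᶠ ε in 𝓝[>] (0 : ℝ), ∀ T : κ, f T x + ε * f T (∑ i, c i • v i) ≠ 0 := by
    rw [eventually_all]
    intro T
    refine eventually_add_mul_ne_zero _ ?_
    have := hcA _ ⟨T, rfl⟩
    simpa [map_sum] using this
  refine h.mono fun ε hε T hT => by_contra fun hne => hε ⟨T, hne⟩ ?_
  have := hfT ⟨T, hne⟩ _ hT
  simpa using this

theorem conicHull_subset_span (v : ι → Fin n → ℝ) :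
    conicHull v ⊆ Submodule.span ℝ (Set.range v) := by
  rintro _ ⟨l, -, rfl⟩
  exact Submodule.sum_mem _ fun i _ => Submodule.smul_mem _ _ (Submodule.subset_span ⟨i, rfl⟩)

end Cones

variable [DecidableEq ι]

/-- The functionals `φ i`, `i ∈ S`, are coordinates with respect to the basis `v i`, `i ∈ S`, of the
span of all `v i`. -/
structure IsCoord (v : ι → Fin n → ℝ) (S : Finset ι) (φ : ι → (Fin n → ℝ) →ₗ[ℝ] ℝ) : Prop where
  expand : ∀ x ∈ Submodule.span ℝ (Set.range v), ∑ i ∈ S, φ i x • v i = x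
  dual : ∀ i ∈ S, ∀ j ∈ S, φ i (v j) = if i = j then 1 else 0

theorem exists_isCoord {v : ι → Fin n → ℝ} {S : Finset ι} (hli : LinearIndepOn ℝ v (S : Set ι))
    (hsp : Submodule.span ℝ (v '' S) = Submodule.span ℝ (Set.range v)) :
    ∃ φ, IsCoord v S φ := by
  have hli' : LinearIndependent ℝ (fun i : S => v i) := hli
  let B := Module.Basis.span hli'
  have hrange : Set.range (fun i : S => v i) = v '' S := by
    ext x
    simp
  have hext : ∀ i : ι, ∃ g : (Fin n → ℝ) →ₗ[ℝ] ℝ, ∀ h : i ∈ S,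
      g ∘ₗ (Submodule.span ℝ (Set.range fun i : S => v i)).subtype = B.coord ⟨i, h⟩ := by
    intro i
    by_cases h : i ∈ S
    · obtain ⟨g, hg⟩ := LinearMap.exists_extend (B.coord ⟨i, h⟩)
      exact ⟨g, fun _ => hg⟩
    · exact ⟨0, fun h' => absurd h' h⟩
  choose φ hφ using hext
  have hval : ∀ (i : S) (x : Submodule.span ℝ (Set.range fun i : S => v i)),
      φ i x = B.repr x i := fun i x => by
    have := LinearMap.congr_fun (hφ i i.2) x
    simpa using this
  refine ⟨φ, ?_, ?_⟩
  · intro x hx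
    rw [← hsp, ← hrange] at hx
    have h := congrArg Subtype.val (B.sum_repr ⟨x, hx⟩)
    rw [← Finset.sum_coe_sort]
    simp only [AddSubmonoidClass.coe_finsetSum, Submodule.coe_smul] at h
    conv_rhs => rw [← h]
    refine Finset.sum_congr rfl fun i _ => ?_
    rw [hval i ⟨x, hx⟩, Module.Basis.span_apply]
  · intro i hi j hj
    have h1 : (B ⟨j, hj⟩ : Fin n → ℝ) = v j :=
      congrArg Subtype.val (Module.Basis.span_apply hli' ⟨j, hj⟩)
    rw [← h1, hval ⟨i, hi⟩ (B ⟨j, hj⟩), Module.Basis.repr_self, Finsupp.single_apply]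
    simp [eq_comm]

theorem IsCoord.linearIndepOn {v : ι → Fin n → ℝ} {S : Finset ι} {φ} (h : IsCoord v S φ) :
    LinearIndepOn ℝ v (S : Set ι) := by
  rw [linearIndepOn_finset_iff]
  intro g hg i hi
  have := congrArg (φ i) hg
  rw [map_sum, map_zero, Finset.sum_congr rfl (fun j hj => by
    rw [map_smul, h.dual i hi j hj])] at this
  simpa [hi] using this

variable [Fintype ι]

/-- The linear relation expressing `v j` through `v i`, `i ∈ S`. -/
def basisRelation (v : ι → Fin n → ℝ) (φ : ι → (Fin n → ℝ) →ₗ[ℝ] ℝ) (S : Finset ι) (j : ι) :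
    ι → ℝ :=
  fun k => (if k = j then 1 else 0) - if k ∈ S then φ k (v j) else 0

theorem sum_basisRelation_smul {v : ι → Fin n → ℝ} {S : Finset ι} {φ} (h : IsCoord v S φ) (j : ι) :
    ∑ k, basisRelation v φ S j k • v k = 0 := by
  have h1 := h.expand (v j) (Submodule.subset_span ⟨j, rfl⟩)
  simp only [basisRelation, sub_smul, Finset.sum_sub_distrib, ite_smul, one_smul, zero_smul]
  simp [h1]

theorem sum_mul_basisRelation {v : ι → Fin n → ℝ} {S : Finset ι} {φ} (c : ι → ℝ) (j : ι) :
    ∑ k, c k * basisRelation v φ S j k = c j - ∑ k ∈ S, c k * φ k (v j) := by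
  simp [basisRelation, mul_sub, Finset.sum_sub_distrib]

/-- Bases whose reduced costs with respect to `c` are positive. -/
def IsOptimalBasis (v : ι → Fin n → ℝ) (φ : Finset ι → ι → (Fin n → ℝ) →ₗ[ℝ] ℝ) (c : ι → ℝ)
    (S : Finset ι) : Prop :=
  IsCoord v S (φ S) ∧ ∀ j, j ∉ S → 0 < ∑ k, c k * basisRelation v (φ S) S j k

/-- A generic cost vector: no optimality condition degenerates. -/
structure IsGenericCost (v : ι → Fin n → ℝ) (φ : Finset ι → ι → (Fin n → ℝ) →ₗ[ℝ] ℝ)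
    (c : ι → ℝ) : Prop where
  dependent : ∀ T : Finset ι, ¬ LinearIndepOn ℝ v (T : Set ι) →
    ∃ a : ι → ℝ, (∀ i, i ∉ T → a i = 0) ∧ ∑ i, a i • v i = 0 ∧ ∑ i, c i * a i ≠ 0
  reduced : ∀ S j, j ∉ S → ∑ k, c k * basisRelation v (φ S) S j k ≠ 0

theorem exists_isGenericCost (v : ι → Fin n → ℝ) (φ : Finset ι → ι → (Fin n → ℝ) →ₗ[ℝ] ℝ) :
    ∃ c, IsGenericCost v φ c := by
  have hdep : ∀ T : {T : Finset ι // ¬ LinearIndepOn ℝ v (T : Set ι)},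
      ∃ a : ι → ℝ, a ≠ 0 ∧ (∀ i, i ∉ T.1 → a i = 0) ∧ ∑ i, a i • v i = 0 := by
    rintro ⟨T, hT⟩
    rw [linearIndepOn_finset_iff] at hT
    push Not at hT
    obtain ⟨g, hg, i, hi, hgi⟩ := hT
    refine ⟨fun i => if i ∈ T then g i else 0, ?_, fun i hi => if_neg hi, ?_⟩
    · exact Function.ne_iff.2 ⟨i, by simpa [hi] using hgi⟩
    · simpa [ite_smul] using hg
  choose aT haT using hdep
  let R : {p : Finset ι × ι // p.2 ∉ p.1} → ι → ℝ := fun p => basisRelation v (φ p.1.1) p.1.1 p.1.2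
  obtain ⟨c, -, hc⟩ := exists_pos_forall_sum_ne_zero (Set.range aT ∪ Set.range R)
    ((Set.finite_range _).union (Set.finite_range _)) (by
      rintro a (⟨T, rfl⟩ | ⟨⟨⟨S, j⟩, hj⟩, rfl⟩)
      · exact (haT T).1
      · refine Function.ne_iff.2 ⟨j, ?_⟩
        simp only at hj
        simp [R, basisRelation, hj])
  exact ⟨c, fun T hT => ⟨aT ⟨T, hT⟩, (haT ⟨T, hT⟩).2.1, (haT ⟨T, hT⟩).2.2,
    hc _ (Or.inl ⟨_, rfl⟩)⟩, fun S j hj => hc _ (Or.inr ⟨⟨(S, j), hj⟩, rfl⟩)⟩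

/-- The basis is the support of an optimal representation. A dependency on the support would be
feasible in both directions, hence of cost zero, against genericity of `c`; genericity of `y` makes
the support spanning. -/
theorem exists_optimalBasis {v : ι → Fin n → ℝ} (ht : (Fin n → ℝ) →ₗ[ℝ] ℝ)
    (hht : ∀ i, 0 < ht (v i)) {φ : Finset ι → ι → (Fin n → ℝ) →ₗ[ℝ] ℝ}
    (hφ : ∀ S : Finset ι, LinearIndepOn ℝ v (S : Set ι) →
      Submodule.span ℝ (v '' S) = Submodule.span ℝ (Set.range v) → IsCoord v S (φ S))
    {c : ι → ℝ} (hc : IsGenericCost v φ c) {y : Fin n → ℝ} (hy : y ∈ conicHull v)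
    (hgen : IsGenericPoint v y) :
    ∃ S, IsOptimalBasis v φ c S ∧ ∀ i ∈ S, 0 < φ S i y := by
  obtain ⟨l, hl, hs, hopt⟩ := exists_optimal_representation ht hht c hy
  let T : Finset ι := Finset.univ.filter fun i => 0 < l i
  have hT0 : ∀ i, i ∉ T → l i = 0 := fun i hi =>
    le_antisymm (not_lt.1 fun h => hi (by simp [T, h])) (hl i)
  have hTpos : ∀ i ∈ T, 0 < l i := fun i hi => by simpa [T] using hi
  have hsT : ∑ i ∈ T, l i • v i = y := by
    rw [← hs]
    refine Finset.sum_subset (Finset.subset_univ T) fun i _ hi => ?_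
    rw [hT0 i hi, zero_smul]
  have hli : LinearIndepOn ℝ v (T : Set ι) := by
    by_contra hdep
    obtain ⟨a, haT, has, hac⟩ := hc.dependent T hdep
    have hzero : ∀ i, l i = 0 → a i = 0 := fun i hi =>
      haT i fun h => (hTpos i h).ne' hi
    have h1 := hopt a has fun i hi => (hzero i hi).ge
    have h2 := hopt (fun i => - a i) (by simpa using has) fun i hi => by simp [hzero i hi]
    simp only [mul_neg, Finset.sum_neg_distrib] at h2
    exact hac (le_antisymm (by linarith) h1)
  have hsp : Submodule.span ℝ (v '' T) = Submodule.span ℝ (Set.range v) := by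
    refine hgen T ?_
    rw [← hsT]
    exact Submodule.sum_mem _ fun i hi =>
      Submodule.smul_mem _ _ (Submodule.subset_span ⟨i, hi, rfl⟩)
  have hco := hφ T hli hsp
  refine ⟨T, ⟨hco, fun j hj => lt_of_le_of_ne ?_ (hc.reduced T j hj).symm⟩, fun i hi => ?_⟩
  · refine hopt _ (sum_basisRelation_smul hco j) fun i hi => ?_
    have hiT : i ∉ T := fun h => (hTpos i h).ne' hi
    simp only [basisRelation, if_neg hiT, sub_zero]
    split_ifs <;> norm_num
  · have : φ T i y = l i := by
      rw [← hsT, map_sum, Finset.sum_congr rfl (fun j hj => by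
        rw [map_smul, hco.dual i hi j hj])]
      simp [hi]
    rw [this]
    exact hTpos i hi

/-- Weak duality: the linear functional `∑ k ∈ S, c k * φ S k` takes the value `c i` at `v i` for `i
∈ S` and less than `c i` elsewhere. Evaluate it on the expansion of `y` in the basis `S'`. -/
theorem IsOptimalBasis.cost_le {v : ι → Fin n → ℝ}
    {φ : Finset ι → ι → (Fin n → ℝ) →ₗ[ℝ] ℝ} {c : ι → ℝ} {S S' : Finset ι}
    (hS : IsOptimalBasis v φ c S) (hS' : IsOptimalBasis v φ c S') {y : Fin n → ℝ}
    (hyW : y ∈ Submodule.span ℝ (Set.range v)) (hy' : ∀ i ∈ S', 0 < φ S' i y) :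
    ∑ k ∈ S, c k * φ S k y ≤ ∑ k ∈ S', c k * φ S' k y ∧
      (¬ S' ⊆ S → ∑ k ∈ S, c k * φ S k y < ∑ k ∈ S', c k * φ S' k y) := by
  have h1 : ∑ k ∈ S, c k * φ S k y = ∑ i ∈ S', φ S' i y * ∑ k ∈ S, c k * φ S k (v i) := by
    have h2 : ∀ k, φ S k y = ∑ i ∈ S', φ S' i y * φ S k (v i) := by
      intro k
      conv_lhs => rw [← hS'.1.expand y hyW]
      simp [map_sum]
    simp only [Finset.mul_sum]
    rw [Finset.sum_comm]
    refine Finset.sum_congr rfl fun k _ => ?_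
    rw [h2 k, Finset.mul_sum]
    exact Finset.sum_congr rfl fun i _ => by ring
  have hin : ∀ i ∈ S, ∑ k ∈ S, c k * φ S k (v i) = c i := by
    intro i hi
    rw [Finset.sum_congr rfl (fun k hk => by rw [hS.1.dual k hk i hi])]
    simp [hi]
  have hout : ∀ i, i ∉ S → ∑ k ∈ S, c k * φ S k (v i) < c i := by
    intro i hi
    have := hS.2 i hi
    rw [sum_mul_basisRelation] at this
    linarith
  have hle : ∀ i ∈ S', φ S' i y * ∑ k ∈ S, c k * φ S k (v i) ≤ c i * φ S' i y := by
    intro i hi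
    rw [mul_comm (c i)]
    refine mul_le_mul_of_nonneg_left ?_ (hy' i hi).le
    by_cases h : i ∈ S
    · exact (hin i h).le
    · exact (hout i h).le
  rw [h1]
  refine ⟨Finset.sum_le_sum hle, fun hsub => ?_⟩
  obtain ⟨i, hi, hiS⟩ := Finset.not_subset.1 hsub
  refine Finset.sum_lt_sum hle ⟨i, hi, ?_⟩
  rw [mul_comm (c i)]
  exact mul_lt_mul_of_pos_left (hout i hiS) (hy' i hi)

theorem IsOptimalBasis.unique {v : ι → Fin n → ℝ}
    {φ : Finset ι → ι → (Fin n → ℝ) →ₗ[ℝ] ℝ} {c : ι → ℝ} {S S' : Finset ι}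
    (hS : IsOptimalBasis v φ c S) (hS' : IsOptimalBasis v φ c S') {y : Fin n → ℝ}
    (hyW : y ∈ Submodule.span ℝ (Set.range v)) (hy : ∀ i ∈ S, 0 < φ S i y)
    (hy' : ∀ i ∈ S', 0 < φ S' i y) : S = S' := by
  have h1 := hS.cost_le hS' hyW hy'
  have h2 := hS'.cost_le hS hyW hy
  refine Finset.Subset.antisymm ?_ ?_ <;> by_contra h
  · exact absurd (h2.2 h) (not_lt.2 h1.1)
  · exact absurd (h1.2 h) (not_lt.2 h2.1)

theorem IsCoord.mem_conicHull {v : ι → Fin n → ℝ} {S : Finset ι} {φ} (h : IsCoord v S φ)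
    {x : Fin n → ℝ} (hx : x ∈ Submodule.span ℝ (Set.range v)) (h0 : ∀ i ∈ S, 0 ≤ φ i x) :
    x ∈ conicHull v := by
  refine ⟨fun i => if i ∈ S then φ i x else 0, fun i => ?_, ?_⟩
  · dsimp only
    split_ifs with hi
    · exact h0 i hi
    · exact le_rfl
  · simpa [ite_smul] using h.expand x hx

/-- A finitely generated pointed cone is a disjoint union of half-open simplicial cones, none of
which is open. -/
theorem exists_halfOpen_decomposition [Nonempty ι] (v : ι → Fin n → ℝ)
    (ht : (Fin n → ℝ) →ₗ[ℝ] ℝ) (hht : ∀ i, 0 < ht (v i)) :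
    ∃ (F : Finset (Finset ι)) (φ : Finset ι → ι → (Fin n → ℝ) →ₗ[ℝ] ℝ) (u : Fin n → ℝ),
      (∀ S ∈ F, IsCoord v S (φ S)) ∧ (∀ S ∈ F, ∃ i ∈ S, 0 < φ S i u) ∧
      (∀ x ∈ Submodule.span ℝ (Set.range v),
        x ∈ conicHull v ↔ ∃ S ∈ F, ∀ i ∈ S, InRay (0 < φ S i u) (φ S i x)) ∧
      ∀ x ∈ Submodule.span ℝ (Set.range v), ∀ S ∈ F, ∀ S' ∈ F,
        (∀ i ∈ S, InRay (0 < φ S i u) (φ S i x)) →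
        (∀ i ∈ S', InRay (0 < φ S' i u) (φ S' i x)) → S = S' := by
  classical
  have hφ' : ∀ S : Finset ι, ∃ φ : ι → (Fin n → ℝ) →ₗ[ℝ] ℝ, LinearIndepOn ℝ v (S : Set ι) →
      Submodule.span ℝ (v '' S) = Submodule.span ℝ (Set.range v) → IsCoord v S φ := by
    intro S
    by_cases h : LinearIndepOn ℝ v (S : Set ι) ∧
        Submodule.span ℝ (v '' S) = Submodule.span ℝ (Set.range v)
    · obtain ⟨φ, hφ⟩ := exists_isCoord h.1 h.2
      exact ⟨φ, fun _ _ => hφ⟩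
    · exact ⟨0, fun h1 h2 => absurd ⟨h1, h2⟩ h⟩
  choose φ hφ using hφ'
  obtain ⟨c, hc⟩ := exists_isGenericCost v φ
  obtain ⟨c', hc', hgen⟩ := exists_generic_direction v
  set u := ∑ i, c' i • v i with hu
  have huC : u ∈ conicHull v := ⟨c', fun i => (hc' i).le, rfl⟩
  have huW := conicHull_subset_span v huC
  have hF : ∀ S, S ∈ Finset.univ.filter (IsOptimalBasis v φ c) ↔ IsOptimalBasis v φ c S := by
    simp
  refine ⟨Finset.univ.filter (IsOptimalBasis v φ c), φ, u, ?_, ?_, ?_, ?_⟩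
  · intro S hS
    exact ((hF S).1 hS).1
  · intro S hS
    have hco := ((hF S).1 hS).1
    -- If no coordinate of `u` were positive, its height would be nonpositive, though `u` is a
    -- positive combination of generators of positive height.
    by_contra! hneg
    have h1 : 0 < ht u := by
      rw [hu, map_sum]
      refine Finset.sum_pos (fun i _ => ?_) Finset.univ_nonempty
      rw [map_smul]
      exact mul_pos (hc' i) (hht i)
    rw [← hco.expand u huW, map_sum] at h1
    refine absurd h1 (not_lt.2 (Finset.sum_nonpos fun i hi => ?_))
    rw [map_smul]
    exact mul_nonpos_of_nonpos_of_nonneg (hneg i hi) (hht i).le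
  · intro x hx
    constructor
    · intro hxC
      have hev : ∀ᶠ ε in 𝓝[>] (0 : ℝ), ∃ S : Finset ι, IsOptimalBasis v φ c S ∧
          ∀ i ∈ S, 0 < φ S i x + ε * φ S i u := by
        filter_upwards [hgen x, self_mem_nhdsWithin] with ε hε hpos
        have hmem : x + ε • u ∈ conicHull v := by
          obtain ⟨l, hl, rfl⟩ := hxC
          refine ⟨fun i => l i + ε * c' i,
            fun i => add_nonneg (hl i) (mul_nonneg (le_of_lt hpos) (hc' i).le), ?_⟩
          simp only [add_smul, Finset.sum_add_distrib, mul_smul]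
          rw [← Finset.smul_sum]
        obtain ⟨S, hS, hSpos⟩ := exists_optimalBasis ht hht hφ hc hmem hε
        exact ⟨S, hS, fun i hi => by simpa using hSpos i hi⟩
      -- Pigeonhole: the basis may vary with `ε`, but there are finitely many.
      have hfr : ∃ S : Finset ι, ∃ᶠ ε in 𝓝[>] (0 : ℝ), IsOptimalBasis v φ c S ∧
          ∀ i ∈ S, 0 < φ S i x + ε * φ S i u := by
        by_contra hcon
        simp only [not_exists, not_frequently] at hcon
        obtain ⟨ε, ⟨S, hS⟩, h2⟩ := (hev.and (eventually_all.2 hcon)).exists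
        exact h2 S hS
      obtain ⟨S, hS⟩ := hfr
      refine ⟨S, (hF S).2 hS.exists.choose_spec.1, fun i hi => ?_⟩
      exact inRay_of_frequently_pos (hS.mono fun ε h => h.2 i hi)
    · rintro ⟨S, hS, hray⟩
      exact ((hF S).1 hS).1.mem_conicHull hx fun i hi => (hray i hi).nonneg
  · intro x hx S hS S' hS' hray hray'
    have hev : ∀ S : Finset ι, (∀ i ∈ S, InRay (0 < φ S i u) (φ S i x)) →
        ∀ᶠ ε in 𝓝[>] (0 : ℝ), ∀ i ∈ S, 0 < φ S i (x + ε • u) := by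
      intro S hS
      rw [Finset.eventually_all]
      intro i hi
      simpa using (hS i hi).eventually_pos
    obtain ⟨ε, h1, h2⟩ := ((hev S hray).and (hev S' hray')).exists
    exact ((hF S).1 hS).unique ((hF S').1 hS')
      (Submodule.add_mem _ hx (Submodule.smul_mem _ _ huW)) h1 h2

end Geometry

end WeightedEhrhart

/-! ### Cones over rational polytopes and assembly of the series -/

namespace WeightedEhrhart

theorem IsPolytope.finite_extremePoints {d : ℕ} {P : Set (Fin d → ℝ)} (hP : IsPolytope P) :
    (P.extremePoints ℝ).Finite := by
  obtain ⟨V, hV, rfl⟩ := hP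
  exact hV.subset extremePoints_convexHull_subset

theorem IsPolytope.convexHull_extremePoints {d : ℕ} {P : Set (Fin d → ℝ)} (hP : IsPolytope P) :
    convexHull ℝ (P.extremePoints ℝ) = P := by
  have hfin := hP.finite_extremePoints
  obtain ⟨V, hV, rfl⟩ := hP
  have h := closure_convexHull_extremePoints (hV.isCompact_convexHull ℝ) (convex_convexHull ℝ V)
  rwa [(hfin.isClosed_convexHull (𝕜 := ℝ)).closure_eq] at h

theorem IsRationalPolytope.exists_isLatticePolytope_smul {d : ℕ} {P : Set (Fin d → ℝ)}
    (hP : IsRationalPolytope P) : ∃ q : ℕ, 0 < q ∧ IsLatticePolytope ((q : ℝ) • P) := by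
  obtain ⟨hpoly, hrat⟩ := hP
  have hfin := hpoly.finite_extremePoints
  choose! a ha using hrat
  -- Any common multiple of the denominators of all vertex coordinates works.
  let q : ℕ := ∏ v ∈ hfin.toFinset, ∏ i, (a v i).den
  have hq : 0 < q := Finset.prod_pos fun v _ => Finset.prod_pos fun i _ => (a v i).den_pos
  have hconv : (q : ℝ) • P = convexHull ℝ ((q : ℝ) • P.extremePoints ℝ) := by
    rw [convexHull_smul, hpoly.convexHull_extremePoints]
  refine ⟨q, hq, ⟨_, hfin.smul_set, hconv⟩, fun v hv i => ?_⟩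
  rw [hconv] at hv
  obtain ⟨x, hx, rfl⟩ := extremePoints_convexHull_subset hv
  obtain ⟨k, hk⟩ : (a x i).den ∣ q :=
    (Finset.dvd_prod_of_mem (fun i => (a x i).den) (Finset.mem_univ i)).trans
      (Finset.dvd_prod_of_mem (fun v => ∏ i, (a v i).den) (hfin.mem_toFinset.2 hx))
  refine ⟨k * (a x i).num, ?_⟩
  have h1 : ((a x i).den : ℝ) * (a x i : ℝ) = (a x i).num := by
    exact_mod_cast Rat.den_mul_eq_num (a x i)
  change (q : ℝ) * x i = _
  rw [ha x hx i, hk]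
  push_cast
  linear_combination (k : ℝ) * h1

theorem cone_eq_conicHull {d : ℕ} {P : Set (Fin d → ℝ)} {q : ℕ} (hq : 0 < q)
    (E : Finset (Fin d → ℝ)) (hE : (q : ℝ) • P = convexHull ℝ (E : Set (Fin d → ℝ)))
    (hP : P.Nonempty) :
    cone P = conicHull (fun e : E => (Fin.snoc e.1 (q : ℝ) : Fin (d + 1) → ℝ)) := by
  have hq' : (0 : ℝ) < q := by exact_mod_cast hq
  ext y
  constructor
  · rintro ⟨c, hc, p, hp, rfl⟩
    have hqp : (q : ℝ) • p ∈ convexHull ℝ (E : Set (Fin d → ℝ)) := hE ▸ Set.smul_mem_smul_set hp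
    obtain ⟨w, hw, hw1, hwp⟩ := Finset.mem_convexHull'.1 hqp
    refine ⟨fun e => c / q * w e, fun e => mul_nonneg (by positivity) (hw e e.2), ?_⟩
    rw [Finset.sum_coe_sort E (fun e => (c / q * w e) • (Fin.snoc e (q : ℝ) : Fin (d + 1) → ℝ))]
    ext k
    simp only [Finset.sum_apply, Pi.smul_apply, smul_eq_mul]
    refine Fin.lastCases ?_ (fun j => ?_) k
    · simp only [Fin.snoc_last]
      rw [← Finset.sum_mul, ← Finset.mul_sum, hw1]
      field_simp
    · simp only [Fin.snoc_castSucc]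
      have h := congrFun hwp j
      simp only [Finset.sum_apply, Pi.smul_apply, smul_eq_mul] at h
      simp only [mul_assoc]
      rw [← Finset.mul_sum, h]
      field_simp
  · rintro ⟨l, hl, rfl⟩
    -- The apex cannot be normalized to a convex combination; it belongs to the cone only because
    -- `P` is nonempty.
    rcases (Finset.sum_nonneg fun e (_ : e ∈ Finset.univ) => hl e).eq_or_lt with h0 | h0
    · obtain ⟨p, hp⟩ := hP
      refine ⟨0, le_rfl, p, hp, ?_⟩
      rw [zero_smul]
      refine Finset.sum_eq_zero fun e he => ?_
      rw [(Finset.sum_eq_zero_iff_of_nonneg fun e _ => hl e).1 h0.symm e he, zero_smul]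
    · set L := ∑ e, l e with hL
      have hmem : ∑ e, (l e / L) • e.1 ∈ (q : ℝ) • P := by
        rw [hE]
        refine mem_convexHull_of_exists_fintype (fun e => l e / L) (fun e : E => e.1)
          (fun e => div_nonneg (hl e) h0.le) ?_ (fun e => e.2) rfl
        rw [← Finset.sum_div, ← hL, div_self h0.ne']
      obtain ⟨p, hp, hpe⟩ := hmem
      refine ⟨q * L, by positivity, p, hp, ?_⟩
      ext k
      simp only [Finset.sum_apply, Pi.smul_apply, smul_eq_mul]
      refine Fin.lastCases ?_ (fun j => ?_) k
      · simp only [Fin.snoc_last]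
        rw [← Finset.sum_mul]
        ring
      · simp only [Fin.snoc_castSucc]
        have h := congrFun hpe j
        simp only [Finset.sum_apply, Pi.smul_apply, smul_eq_mul] at h
        rw [mul_right_comm, h, Finset.sum_mul]
        refine Finset.sum_congr rfl fun e _ => ?_
        field_simp

/-- Linear independence of the vectors `(q p, q)` gives affine independence of the points `p` of
`P`: the last coordinate encodes that the weights sum to zero. -/
theorem card_le_finrank_vectorSpan_add_one {d : ℕ} {P : Set (Fin d → ℝ)} {q : ℕ} (hq : 0 < q)
    {ι : Type*} {S : Finset ι} (e : ι → Fin d → ℝ) (he : ∀ i, e i ∈ (q : ℝ) • P)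
    (hli : LinearIndepOn ℝ (fun i => (Fin.snoc (e i) (q : ℝ) : Fin (d + 1) → ℝ)) (S : Set ι)) :
    S.card ≤ Module.finrank ℝ (vectorSpan ℝ P) + 1 := by
  have hq' : (q : ℝ) ≠ 0 := by exact_mod_cast hq.ne'
  choose p hp hpe using he
  have haff : AffineIndependent ℝ (fun i : S => p i) := by
    rw [affineIndependent_iff]
    intro s w hw hs
    refine linearIndependent_iff'.1 hli s w ?_
    ext k
    simp only [Finset.sum_apply, Pi.smul_apply, smul_eq_mul, Pi.zero_apply]
    refine Fin.lastCases ?_ (fun j => ?_) k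
    · simp only [Fin.snoc_last]
      rw [← Finset.sum_mul, hw, zero_mul]
    · simp only [Fin.snoc_castSucc, ← hpe]
      have h := congrFun hs j
      simp only [Finset.sum_apply, Pi.smul_apply, smul_eq_mul, Pi.zero_apply] at h
      simp only [Pi.smul_apply, smul_eq_mul]
      calc ∑ x ∈ s, w x * (q * p x j) = q * ∑ x ∈ s, w x * p x j := by
            rw [Finset.mul_sum]
            exact Finset.sum_congr rfl fun _ _ => by ring
        _ = 0 := by rw [h, mul_zero]
  have h := haff.card_le_finrank_succ
  rw [Fintype.card_coe] at h
  refine h.trans (Nat.add_le_add_right (Submodule.finrank_mono (vectorSpan_mono ℝ ?_)) 1)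
  rintro _ ⟨i, rfl⟩
  exact hp i

theorem ehrhartSeries_mul_pow {d : ℕ} {P : Set (Fin d → ℝ)} (hPoly : IsPolytope P)
    (hne : P.Nonempty) {m : ℕ} {w : MvPolynomial (Fin (d + 1)) ℝ} (hw : w.IsHomogeneous m)
    {q : ℕ} (hq : 0 < q) (hlat : IsLatticePolytope ((q : ℝ) • P)) :
    ∃ h : Polynomial ℝ,
      h.degree < ((q * (Module.finrank ℝ (vectorSpan ℝ P) + 1 + m) : ℕ) : WithBot ℕ) ∧
      ehrhartSeries P w * (1 - PowerSeries.X ^ q) ^ (Module.finrank ℝ (vectorSpan ℝ P) + 1 + m)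
        = (h : PowerSeries ℝ) := by
  classical
  obtain ⟨hQ, hint⟩ := hlat
  have hfin := hQ.finite_extremePoints
  set E : Finset (Fin d → ℝ) := hfin.toFinset with hEdef
  have hE : (q : ℝ) • P = convexHull ℝ (E : Set (Fin d → ℝ)) := by
    rw [hEdef, hfin.coe_toFinset, hQ.convexHull_extremePoints]
  have hEQ : ∀ e : E, e.1 ∈ (q : ℝ) • P := fun e => hE ▸ subset_convexHull ℝ _ e.2
  have hEne : Nonempty E := by
    have : (convexHull ℝ (E : Set (Fin d → ℝ))).Nonempty := hE ▸ hne.smul_set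
    exact (convexHull_nonempty_iff.1 this).to_subtype
  have hint' : ∀ (e : E) i, ∃ a : ℤ, e.1 i = (a : ℝ) := fun e i =>
    hint e.1 (hfin.mem_toFinset.1 e.2) i
  choose ez hez using hint'
  let vz : E → Fin (d + 1) → ℤ := fun e => Fin.snoc (ez e) (q : ℤ)
  let v : E → Fin (d + 1) → ℝ := fun e => Fin.snoc e.1 (q : ℝ)
  have hvz : ∀ e, (fun k => (vz e k : ℝ)) = v e := by
    intro e
    ext k
    refine Fin.lastCases ?_ (fun j => ?_) k
    · simp [vz, v]
    · simp [vz, v, hez]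
  have hcone : cone P = conicHull v := cone_eq_conicHull hq E hE hne
  have hq' : (0 : ℝ) < q := by exact_mod_cast hq
  obtain ⟨F, φ, u, hco, hpos, hdec, huniq⟩ := exists_halfOpen_decomposition v
    (LinearMap.proj (Fin.last d)) (fun e => by simpa [v] using hq')
  set W := Submodule.span ℝ (Set.range v)
  let X : Finset E → Set (Fin (d + 1) → ℤ) := fun S =>
    halfOpenPoints W S (φ S) (fun i => 0 < φ S i u) S
  have hXmem : ∀ S x, x ∈ X S ↔ (fun i => (x i : ℝ)) ∈ W ∧
      ∀ i ∈ S, InRay (0 < φ S i u) (φ S i fun i => (x i : ℝ)) := by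
    intro S x
    refine ⟨fun h => ⟨h.1, h.2.1⟩, fun h => ⟨h.1, h.2, fun i hi hi' => absurd hi hi'⟩⟩
  have hunion : {x : Fin (d + 1) → ℤ | (fun i => (x i : ℝ)) ∈ cone P} = ⋃ S ∈ F, X S := by
    ext x
    simp only [Set.mem_iUnion, hXmem, exists_prop, Set.mem_ofPred_eq, hcone]
    constructor
    · intro hx
      have hxW := conicHull_subset_span v hx
      obtain ⟨S, hS, h⟩ := (hdec _ hxW).1 hx
      exact ⟨S, hS, hxW, h⟩
    · rintro ⟨S, hS, hxW, h⟩
      exact (hdec _ hxW).2 ⟨S, hS, h⟩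
  have hXfin : ∀ S ∈ F, ∀ n, (slice (X S) n).Finite := by
    intro S hS n
    refine (latticeSlice_finite hPoly n).subset fun x hx => ⟨?_, hx.2⟩
    have : x ∈ ⋃ S ∈ F, X S := Set.mem_biUnion hS hx.1
    rwa [← hunion] at this
  have hseries : ehrhartSeries P w = ∑ S ∈ F, heightSeries (X S)
      (fun x => MvPolynomial.eval (fun i => (x i : ℝ)) w) := by
    rw [← heightSeries_biUnion F X hXfin, ← hunion]
    · rfl
    · intro S hS S' hS' hSS'
      refine Set.disjoint_left.2 fun x hx hx' => hSS' ?_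
      rw [hXmem] at hx hx'
      exact huniq _ hx.1 S hS S' hS' hx.2 hx'.2
  have hpiece : ∀ S ∈ F, ∃ h : Polynomial ℝ,
      h.degree < ((q * (Module.finrank ℝ (vectorSpan ℝ P) + 1 + m) : ℕ) : WithBot ℕ) ∧
      heightSeries (X S) (fun x => MvPolynomial.eval (fun i => (x i : ℝ)) w) *
        (1 - PowerSeries.X ^ q) ^ (Module.finrank ℝ (vectorSpan ℝ P) + 1 + m)
        = (h : PowerSeries ℝ) := by
    intro S hS
    have hcard : S.card ≤ Module.finrank ℝ (vectorSpan ℝ P) + 1 :=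
      card_le_finrank_vectorSpan_add_one hq (fun e : E => e.1) hEQ (hco S hS).linearIndepOn
    -- `k` is the number of denominator factors this piece lacks; it is zero when the cone has full
    -- dimension `dim P + 1`.
    obtain ⟨k, hk⟩ := Nat.exists_eq_add_of_le hcard
    have h := halfOpenPoints_heightSeries (W := W) (S := S) (φ := φ S)
      (b := fun i => 0 < φ S i u) hq vz (fun i => by simp [vz])
      (fun i => by rw [hvz]; exact Submodule.subset_span ⟨i, rfl⟩)
      (by simpa only [hvz] using (hco S hS).expand) (by simpa only [hvz] using (hco S hS).dual)
      (hpos S hS) (hXfin S hS) S (Finset.Subset.refl S) m _ (isPolyLE_eval hw)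
    have h' := exists_polynomial_mul h k
    rw [hk]
    convert h' using 6 <;> ring
  choose! h hdeg heq using hpiece
  refine ⟨∑ S ∈ F, h S, ?_, ?_⟩
  · refine lt_of_le_of_lt (Polynomial.degree_sum_le _ _) ?_
    exact (Finset.sup_lt_iff (WithBot.bot_lt_coe _)).2 hdeg
  · rw [hseries, Finset.sum_mul, Finset.sum_congr rfl heq]
    exact (map_sum (Polynomial.coeToPowerSeries.ringHom (R := ℝ)) h F).symm

end WeightedEhrhart

theorem proposition2p3 (d : ℕ) (P : Set (Fin d → ℝ))
    (hP : WeightedEhrhart.IsRationalPolytope P)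
    (r : ℤ) (hr : WeightedEhrhart.dimension P = r)
    (m : ℕ) (w : MvPolynomial (Fin (d + 1)) ℝ) (hw : w.IsHomogeneous m) :
    (∃ q : ℕ, 0 < q ∧ WeightedEhrhart.IsLatticePolytope ((q : ℝ) • P)) ∧
    ∀ q : ℕ, 0 < q → WeightedEhrhart.IsLatticePolytope ((q : ℝ) • P) →
      ∃ h : Polynomial ℝ,
        h.degree < ((q * (r + m + 1).toNat : ℕ) : WithBot ℕ) ∧
        WeightedEhrhart.ehrhartSeries P w * (1 - PowerSeries.X ^ q) ^ (r + m + 1).toNat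
          = (h : PowerSeries ℝ) := by
  refine ⟨hP.exists_isLatticePolytope_smul, fun q hq hlat => ?_⟩
  rcases P.eq_empty_or_nonempty with rfl | hne
  · refine ⟨0, by rw [Polynomial.degree_zero]; exact WithBot.bot_lt_coe _, ?_⟩
    have h : WeightedEhrhart.ehrhartSeries (∅ : Set (Fin d → ℝ)) w = 0 := by
      ext n
      simp [WeightedEhrhart.ehrhartSeries, WeightedEhrhart.latticeSlice, WeightedEhrhart.cone]
    rw [h, zero_mul, Polynomial.coe_zero]
  · have hN : (r + m + 1).toNat = Module.finrank ℝ (vectorSpan ℝ P) + 1 + m := by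
      rw [WeightedEhrhart.dimension, if_pos hne] at hr
      omega
    rw [hN]
    exact WeightedEhrhart.ehrhartSeries_mul_pow hP.1 hne hw hq hlat
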